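/- Let $C\subseteq\mathbb{R}^n$ be a nonempty convex set, let $f:\mathbb{R}^n\to\mathbb{R}$ be continuously differentiable on $C$, let $g:\mathbb{R}^m\to\mathbb{R}\cup\{\infty\}$ be polyhedral convex (its epigraph is a finite intersection of closed half-spaces), and let $A:\mathbb{R}^n\to\mathbb{R}^m$ be linear with $Ax\in\operatorname{dom} g$ for some $x\in\operatorname{ri}(C)$. Write $\delta_C$ for the indicator function of $C$ (equal to $0$ on $C$ and $\infty$ elsewhere), $\partial$ for the subdifferential of convex analysis, and $V_C:=\operatorname{aff}(C)-x$ ($x\in C$ arbitrary) for the linear subspace parallel to the affine hull of $C$. For $\lambda\in\partial g(y)$ put $$T_g(y\mid\lambda):=\{w\in\mathbb{R}^m : g'(y;w)=\langle\lambda,w\rangle\},\qquad S(y\mid\lambda):=T_g(y\mid\lambda)-T_g(y\mid\lambda),$$ where $g'(y;w)$ is the one-sided directional derivative; $S(y\mid\lambda)$ is the smallest linear subspace containing the convex cone $T_g(y\mid\lambda)$. For $\beta>0$ define the augmented Lagrangian and the reduced augmented Lagrangian by $$L_\beta(x,y,\lambda):=f(x)+\delta_C(x)+g(y)+\langle\lambda,Ax-y\rangle+\tfrac{\beta}{2}\|Ax-y\|^2,\qquad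 l_\beta(x,\lambda):=\min_{y\in\mathbb{R}^m}L_\beta(x,y,\lambda).$$ Let $(\bar x,\bar\lambda)\in\mathbb{R}^n\times\mathbb{R}^m$ be such that: (i) $0\in\partial\delta_C(\bar x)+\nabla f(\bar x)+A^{\top}\bar\lambda$ and $\bar\lambda\in\partial g(A\bar x)$; (ii) $\nabla^2 f$ exists and is continuous on a neighborhood of $\bar x$, and $\langle\nabla^2 f(\bar x)v,v\rangle>0$ for every nonzero $v\in V_C$ with $Av\in S(A\bar x\mid\bar\lambda)$. Then strong variational sufficiency holds at $(\bar x,\bar\lambda)$: there is $\beta_0>0$ such that for every $\beta\ge\beta_0$ there are convex neighborhoods $\mathcal{X}_\beta$ of $\bar x$ and $\Lambda_\beta$ of $\bar\lambda$ and a number $\sigma>0$ such that, for every $\lambda\in\Lambda_\beta$, the extended-real-valued function $l_\beta(\cdot,\lambda)$ is strongly convex on $\mathcal{X}_\beta$ with modulus $\sigma$, and, for every $x\in\mathcal{X}_\beta$, the function $l_\beta(x,\cdot)$ is concave on $\Lambda_\beta$. -/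

import Mathlib

open Filter Topology
open scoped InnerProductSpace

noncomputable section

namespace CompositeOpt

/-- A polyhedral convex set: the intersection of finitely many closed half-spaces, that is, the
solution set of a finite system of linear inequalities. -/
def IsPolyhedralSet {V : Type*} [AddCommGroup V] [Module ℝ V] (S : Set V) : Prop :=
  ∃ (k : ℕ) (c : Fin k → Module.Dual ℝ V) (b : Fin k → ℝ), S = {v | ∀ i, c i v ≤ b i}

section

variable {E F : Type*}
  [NormedAddCommGroup E] [InnerProductSpace ℝ E]
  [NormedAddCommGroup F] [InnerProductSpace ℝ F]

/-- A polyhedral convex function with values in `ℝ ∪ {∞}`: the value `-∞` is not taken and the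
epigraph is a polyhedral convex set. -/
def IsPolyhedralFunction (φ : E → EReal) : Prop :=
  (∀ x, φ x ≠ ⊥) ∧ IsPolyhedralSet {p : E × ℝ | φ p.1 ≤ (p.2 : EReal)}

/-- The subdifferential of convex analysis; it is empty outside the effective domain. -/
def subdifferential (φ : E → EReal) (x : E) : Set E :=
  {s | φ x ≠ ⊤ ∧ ∀ z, φ x + ((⟪s, z - x⟫_ℝ : ℝ) : EReal) ≤ φ z}

open Classical in
/-- The indicator function `δ_C`, with value `0` on `C` and `∞` elsewhere. -/
def indicatorFun (C : Set E) (x : E) : EReal := if x ∈ C then 0 else ⊤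

/-- `HasDirDeriv φ x w d` : the one-sided directional derivative `φ'(x; w)`, i.e. the limit of
`(φ (x + t w) - φ x) / t` as `t ↓ 0`, exists in the extended reals and equals `d`. -/
def HasDirDeriv (φ : E → EReal) (x w : E) (d : EReal) : Prop :=
  Tendsto (fun t : ℝ => (φ (x + t • w) - φ x) / (t : EReal)) (𝓝[>] (0 : ℝ)) (𝓝 d)

/-- The cone `T_φ(x ∣ s) = {w ∣ φ'(x; w) = ⟨s, w⟩}`. -/
def critCone (φ : E → EReal) (x s : E) : Set E :=
  {w | HasDirDeriv φ x w ((⟪s, w⟫_ℝ : ℝ) : EReal)}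

/-- `S(x ∣ s) = T_φ(x ∣ s) - T_φ(x ∣ s)`, the smallest subspace containing the convex cone
`T_φ(x ∣ s)`. -/
def critSpan (φ : E → EReal) (x s : E) : Submodule ℝ E :=
  Submodule.span ℝ (critCone φ x s)

/-- The Hessian `∇²f(x)`, as a linear operator: the derivative of the gradient. -/
def hessian [CompleteSpace E] (f : E → ℝ) (x : E) : E →L[ℝ] E := fderiv ℝ (gradient f) x

/-- `∇²f` exists (so `f` and `∇f` are differentiable) at every point of some neighborhood of `x`
and is continuous there. -/
def HessianContinuousNear [CompleteSpace E] (f : E → ℝ) (x : E) : Prop :=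
  ∃ U ∈ 𝓝 x, (∀ z ∈ U, DifferentiableAt ℝ f z ∧ DifferentiableAt ℝ (gradient f) z) ∧
    ContinuousOn (hessian f) U

/-- `f` is continuously differentiable on `C`. -/
def ContDiffOnSet [CompleteSpace E] (f : E → ℝ) (C : Set E) : Prop :=
  (∀ z ∈ C, DifferentiableAt ℝ f z) ∧ ContinuousOn (gradient f) C

/-- First-order optimality condition for minimizing `f x + g (A x)` over `x ∈ C`:
`0 ∈ ∂δ_C(x) + ∇f(x) + Aᵀ s` and `s ∈ ∂g(A x)`. -/
def FirstOrderCondition [CompleteSpace E] [CompleteSpace F] (C : Set E) (f : E → ℝ)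
    (g : F → EReal) (A : E →L[ℝ] F) (x : E) (s : F) : Prop :=
  (∃ ν ∈ subdifferential (indicatorFun C) x, ν + gradient f x + A.adjoint s = 0) ∧
    s ∈ subdifferential g (A x)

/-- Second-order condition: `∇²f` exists and is continuous near `x`, and `∇²f(x)` is positive
definite relative to `V_C ∩ {v ∣ A v ∈ S(A x ∣ s)}`, where `V_C = aff C - x` is the direction of
the affine hull of `C`. -/
def SecondOrderCondition [CompleteSpace E] (C : Set E) (f : E → ℝ)
    (g : F → EReal) (A : E →L[ℝ] F) (x : E) (s : F) : Prop :=
  HessianContinuousNear f x ∧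
    ∀ v ∈ (affineSpan ℝ C).direction, A v ∈ critSpan g (A x) s → v ≠ 0 →
      0 < ⟪hessian f x v, v⟫_ℝ

/-- The augmented Lagrangian
`L_β(x, y, s) = f x + δ_C(x) + g y + ⟨s, A x - y⟩ + (β / 2) ‖A x - y‖²`. -/
def augLagrangian (C : Set E) (f : E → ℝ) (g : F → EReal) (A : E →L[ℝ] F) (β : ℝ)
    (x : E) (y s : F) : EReal :=
  (f x : EReal) + indicatorFun C x + g y +
    ((⟪s, A x - y⟫_ℝ + β / 2 * ‖A x - y‖ ^ 2 : ℝ) : EReal)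

/-- The reduced augmented Lagrangian `l_β(x, s)`, the minimum of `L_β(x, y, s)` over `y`. -/
def reducedLagrangian (C : Set E) (f : E → ℝ) (g : F → EReal) (A : E →L[ℝ] F) (β : ℝ)
    (x : E) (s : F) : EReal :=
  ⨅ y : F, augLagrangian C f g A β x y s

/-- Strong convexity with modulus `σ`, on a set `X`, of an extended-real-valued function. -/
def StronglyConvexOn (X : Set E) (σ : ℝ) (φ : E → EReal) : Prop :=
  ∀ x ∈ X, ∀ z ∈ X, ∀ a b : ℝ, 0 < a → 0 < b → a + b = 1 →
    φ (a • x + b • z) + ((σ / 2 * (a * b) * ‖x - z‖ ^ 2 : ℝ) : EReal) ≤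
      (a : EReal) * φ x + (b : EReal) * φ z

/-- Concavity, on a set `Y`, of an extended-real-valued function. -/
def IsConcaveOn (Y : Set F) (ψ : F → EReal) : Prop :=
  ∀ s ∈ Y, ∀ r ∈ Y, ∀ a b : ℝ, 0 < a → 0 < b → a + b = 1 →
    (a : EReal) * ψ s + (b : EReal) * ψ r ≤ ψ (a • s + b • r)

/-- Strong variational sufficiency at `(x, s)`: for all sufficiently large `β` there is a
(convex) neighborhood `X × Λ` of `(x, s)` such that the reduced augmented Lagrangian is strongly
convex in the first variable on `X`, for every multiplier in `Λ` (with a common modulus), and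
concave in the second variable on `Λ`, for every point of `X`. -/
def StrongVariationalSufficiency (C : Set E) (f : E → ℝ) (g : F → EReal) (A : E →L[ℝ] F)
    (x : E) (s : F) : Prop :=
  ∃ β₀ : ℝ, 0 < β₀ ∧ ∀ β : ℝ, β₀ ≤ β →
    ∃ X ∈ 𝓝 x, ∃ Λ ∈ 𝓝 s, Convex ℝ X ∧ Convex ℝ Λ ∧
      (∃ σ : ℝ, 0 < σ ∧ ∀ r ∈ Λ,
        StronglyConvexOn X σ (fun z => reducedLagrangian C f g A β z r)) ∧
      ∀ z ∈ X, IsConcaveOn Λ (fun r => reducedLagrangian C f g A β z r)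

end

end CompositeOpt

end

/-! Take v = x - z with x, z ∈ C near `x₀`, and let y, w be the minimizing inner variables for x, z
at a common multiplier s. Using a • y + b • w as a trial point at a • x + b • z shows that the
convexity gap of the reduced Lagrangian is at least the gap of f plus (β/2)ab‖Av - (y - w)‖²
(`reducedLagrangian_combo_le`). The gap of f is nearly (ab/2)⟨Hv, v⟩, with H the Hessian at `x₀`
(`HessianContinuousNear.exists_convexity_gap`). So it suffices that ⟨Hv, v⟩ + β‖Av - (y - w)‖²
dominates σ‖v‖². By `exists_penalty` the second-order condition gives this once y - w lies in the
critical span. That membership is where polyhedrality enters: optimality of y puts (y, s + β(Ax -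
y)) on the graph of ∂g, close to the reference pair (`exists_proximal_point`), and nearby graph
points differ from the reference point by critical directions (`exists_sub_mem_critCone`). -/

namespace CompositeOpt

/-! ### Polyhedral functions: critical directions and proximal points. -/

section Polyhedral

variable {F : Type*} [NormedAddCommGroup F] [InnerProductSpace ℝ F]

theorem IsPolyhedralFunction.le_combo {g : F → EReal} (hg : IsPolyhedralFunction g)
    {y z : F} {s t a b : ℝ} (hy : g y ≤ (s : EReal)) (hz : g z ≤ (t : EReal))
    (ha : 0 ≤ a) (hb : 0 ≤ b) (hab : a + b = 1) :
    g (a • y + b • z) ≤ ((a * s + b * t : ℝ) : EReal) := by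
  obtain ⟨-, k, c, d, hS⟩ := hg
  have mem (p : F × ℝ) : g p.1 ≤ (p.2 : EReal) ↔ ∀ i, c i p ≤ d i :=
    Set.ext_iff.1 hS p
  have hy' := (mem (y, s)).1 hy
  have hz' := (mem (z, t)).1 hz
  refine (mem (a • y + b • z, a * s + b * t)).2 fun i => ?_
  have hp : (a • y + b • z, a * s + b * t) = a • (y, s) + b • (z, t) := by
    simp
  rw [hp, map_add, map_smul, map_smul, smul_eq_mul, smul_eq_mul]
  calc a * c i (y, s) + b * c i (z, t) ≤ a * d i + b * d i := by
        gcongr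
        · exact hy' i
        · exact hz' i
    _ = d i := by rw [← add_mul, hab, one_mul]

theorem IsPolyhedralFunction.isClosed_epigraph [FiniteDimensional ℝ F] {g : F → EReal}
    (hg : IsPolyhedralFunction g) : IsClosed {p : F × ℝ | g p.1 ≤ (p.2 : EReal)} := by
  obtain ⟨-, k, c, d, hS⟩ := hg
  rw [hS, Set.ofPred_forall]
  exact isClosed_iInter fun i =>
    isClosed_le (c i).continuous_of_finiteDimensional continuous_const

theorem coe_toReal_of_mem_subdifferential {g : F → EReal} (hg : IsPolyhedralFunction g)
    {y s : F} (hs : s ∈ subdifferential g y) : (((g y).toReal : ℝ) : EReal) = g y :=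
  EReal.coe_toReal hs.1 (hg.1 y)

theorem subgradient_le {g : F → EReal} (hg : IsPolyhedralFunction g)
    {y s z : F} {t : ℝ} (hs : s ∈ subdifferential g y) (hz : g z ≤ (t : EReal)) :
    (g y).toReal + ⟪s, z - y⟫_ℝ ≤ t := by
  have h := (hs.2 z).trans hz
  rw [← coe_toReal_of_mem_subdifferential hg hs] at h
  exact_mod_cast h

/-- The tangent cone of a polyhedron: small steps from a point near `p₀` along a direction that
does not increase the constraints active at `p₀` stay in the polyhedron. -/
theorem eventually_add_smul_mem {V ι : Type*} [AddCommGroup V] [Module ℝ V] [Finite ι]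
    (c : ι → Module.Dual ℝ V) (d : ι → ℝ) (active : ι → Prop) {p v : V}
    (hact : ∀ i, active i → c i p ≤ d i ∧ c i v ≤ 0) (hinact : ∀ i, ¬ active i → c i p < d i) :
    ∃ t : ℝ, 0 < t ∧ ∀ i, c i (p + t • v) ≤ d i := by
  have h : ∀ᶠ t : ℝ in 𝓝[>] 0, ∀ i, c i (p + t • v) ≤ d i := by
    refine eventually_all.2 fun i => ?_
    by_cases hi : active i
    · filter_upwards [self_mem_nhdsWithin] with t ht
      rw [map_add, map_smul, smul_eq_mul]
      have := mul_nonpos_of_nonneg_of_nonpos (le_of_lt ht) (hact i hi).2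
      linarith [(hact i hi).1]
    · have hc : Tendsto (fun t : ℝ => c i p + t * c i v) (𝓝[>] 0) (𝓝 (c i p + 0 * c i v)) :=
        ((continuous_const.add (continuous_id.mul continuous_const)).tendsto 0).mono_left
          nhdsWithin_le_nhds
      rw [zero_mul, add_zero] at hc
      filter_upwards [hc.eventually (gt_mem_nhds (hinact i hi))] with t ht
      rw [map_add, map_smul, smul_eq_mul]
      exact le_of_lt ht
  obtain ⟨t, ht, ht0⟩ := (h.and self_mem_nhdsWithin).exists
  exact ⟨t, ht0, ht⟩

/-- On the graph of the subdifferential of a polyhedral function, all points near a given one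
differ from it by critical directions. -/
theorem exists_sub_mem_critCone [FiniteDimensional ℝ F] {g : F → EReal}
    (hg : IsPolyhedralFunction g) {y₀ s₀ : F} (hs₀ : s₀ ∈ subdifferential g y₀) :
    ∃ ε > 0, ∀ y s : F, ‖y - y₀‖ < ε → ‖s - s₀‖ < ε → s ∈ subdifferential g y →
      y - y₀ ∈ critCone g y₀ s₀ := by
  obtain ⟨k, c, d, hS⟩ := hg.2
  have mem (p : F × ℝ) : g p.1 ≤ (p.2 : EReal) ↔ ∀ i, c i p ≤ d i :=
    Set.ext_iff.1 hS p
  set t₀ := (g y₀).toReal with ht₀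
  have hgt₀ : g y₀ = (t₀ : EReal) := (coe_toReal_of_mem_subdifferential hg hs₀).symm
  set p₀ : F × ℝ := (y₀, t₀) with hp₀
  have hp₀mem := (mem p₀).1 hgt₀.le
  have hinact : ∀ᶠ p in 𝓝 p₀, ∀ i, c i p₀ ≠ d i → c i p < d i := by
    refine eventually_all.2 fun i => ?_
    by_cases hi : c i p₀ = d i
    · simp [hi]
    · have := ((c i).continuous_of_finiteDimensional.tendsto p₀).eventually
        (gt_mem_nhds (lt_of_le_of_ne (hp₀mem i) hi))
      filter_upwards [this] with p hp _ using hp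
  -- `K` is the tangent cone of the epigraph at `p₀`, `J p` labels the relatively open face of `K`
  -- containing p, and `N I s` says that the functional (s, -1) vanishes on face I.
  let K : Set (F × ℝ) := {p | ∀ i, c i p₀ = d i → c i p ≤ 0}
  let J (p : F × ℝ) : Set (Fin k) := {i | c i p₀ = d i ∧ c i p = 0}
  let N (I : Set (Fin k)) (s : F) : Prop := ∀ p ∈ K, J p = I → ⟪s, p.1⟫_ℝ = p.2
  -- Failure of `N I` at `s₀` is witnessed by one p, hence persists for s near `s₀`; there are only
  -- finitely many faces I.
  have hN : ∀ᶠ s in 𝓝 s₀, ∀ I, N I s → N I s₀ := by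
    refine eventually_all.2 fun I => ?_
    by_cases hI : N I s₀
    · exact Eventually.of_forall fun _ _ => hI
    · simp only [N, not_forall] at hI
      obtain ⟨p, hpK, hpI, hp⟩ := hI
      have hcont : Continuous fun s : F => ⟪s, p.1⟫_ℝ := by fun_prop
      filter_upwards [hcont.continuousAt.eventually_ne hp] with s hs hsN
      exact absurd (hsN p hpK hpI) hs
  obtain ⟨δ₁, hδ₁, h₁⟩ := Metric.eventually_nhds_iff.1 hinact
  obtain ⟨δ₂, hδ₂, h₂⟩ := Metric.eventually_nhds_iff.1 hN
  have hM : 0 < ‖s₀‖ + 1 := by positivity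
  -- The bound 1 keeps ‖s‖ ≤ ‖s₀‖ + 1; then δ₁/(‖s₀‖ + 1) forces |t - t₀| < δ₁ through the two
  -- subgradient inequalities.
  refine ⟨min (min δ₁ (δ₁ / (‖s₀‖ + 1))) (min δ₂ 1),
    lt_min (lt_min hδ₁ (by positivity)) (lt_min hδ₂ one_pos), fun y s hy hsn hs => ?_⟩
  obtain ⟨⟨hy₁, hy₂⟩, -, -⟩ := (lt_min_iff.1 hy).imp lt_min_iff.1 lt_min_iff.1
  obtain ⟨-, hsn₁, hsn₂⟩ := (lt_min_iff.1 hsn).imp lt_min_iff.1 lt_min_iff.1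
  set t := (g y).toReal with ht
  have hgt : g y = (t : EReal) := (coe_toReal_of_mem_subdifferential hg hs).symm
  have hlow : ⟪s₀, y - y₀⟫_ℝ ≤ t - t₀ := by linarith [subgradient_le hg hs₀ hgt.le]
  have hupp : t - t₀ ≤ ⟪s, y - y₀⟫_ℝ := by
    have := subgradient_le hg hs hgt₀.le
    rw [← neg_sub y y₀, inner_neg_right] at this
    linarith
  have hsnorm : ‖s‖ ≤ ‖s₀‖ + 1 := by
    have := norm_add_le (s - s₀) s₀
    rw [sub_add_cancel] at this
    linarith
  have hMy : (‖s₀‖ + 1) * ‖y - y₀‖ < δ₁ := by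
    rwa [mul_comm, ← lt_div_iff₀ hM]
  have habs : |t - t₀| < δ₁ := by
    refine lt_of_le_of_lt ?_ hMy
    rw [abs_le]
    constructor
    · have h1 := (abs_le.1 (abs_real_inner_le_norm s₀ (y - y₀))).1
      have : ‖s₀‖ * ‖y - y₀‖ ≤ (‖s₀‖ + 1) * ‖y - y₀‖ := by gcongr; linarith
      linarith
    · have h1 := (abs_le.1 (abs_real_inner_le_norm s (y - y₀))).2
      have : ‖s‖ * ‖y - y₀‖ ≤ (‖s₀‖ + 1) * ‖y - y₀‖ := by gcongr
      linarith
  have hslack : ∀ i, c i p₀ ≠ d i → c i (y, t) < d i := by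
    refine @h₁ (y, t) ?_
    rw [Prod.dist_eq, max_lt_iff, dist_eq_norm, Real.dist_eq]
    exact ⟨hy₁, habs⟩
  have hyt := (mem (y, t)).1 hgt.le
  have hnormal : ∀ p ∈ K, ⟪s, p.1⟫_ℝ ≤ p.2 := by
    intro p hp
    obtain ⟨τ, hτ, hmem⟩ := eventually_add_smul_mem c d (fun i => c i p₀ = d i) (p := (y, t))
      (v := p) (fun i hi => ⟨hyt i, hp i hi⟩) hslack
    have := subgradient_le hg hs ((mem _).2 hmem)
    simp only [Prod.fst_add, Prod.snd_add, Prod.smul_fst, Prod.smul_snd, add_sub_cancel_left,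
      inner_smul_right, smul_eq_mul] at this
    exact le_of_mul_le_mul_left (by linarith) hτ
  let q : F × ℝ := (y - y₀, t - t₀)
  have hqsub : q = (y, t) - p₀ := rfl
  have hqK : q ∈ K := fun i hi => by
    rw [hqsub, map_sub, hi]
    linarith [hyt i]
  have hsq : ⟪s, q.1⟫_ℝ = q.2 := le_antisymm (hnormal q hqK) hupp
  -- The functional (s, -1) is nonpositive on `K` and zero at q. If p lies in the same open face, q
  -- - τp stays in `K` for small τ > 0, so the functional is also nonnegative at p.
  have hNs : N (J q) s := by
    intro p hpK hpJ
    refine le_antisymm (hnormal p hpK) ?_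
    obtain ⟨τ, hτ, hmem⟩ := eventually_add_smul_mem (fun i : {i // c i p₀ = d i} => c i) 0
      (fun i => (i : Fin k) ∈ J q) (p := q) (v := -p) (by
        intro i hi
        refine ⟨hqK i i.2, ?_⟩
        have : (i : Fin k) ∈ J p := hpJ ▸ hi
        rw [map_neg, this.2, neg_zero]) (by
        intro i hi
        exact lt_of_le_of_ne (hqK i i.2) fun h => hi ⟨i.2, h⟩)
    have := hnormal _ fun i hi => hmem ⟨i, hi⟩
    simp only [Prod.fst_add, Prod.snd_add, Prod.smul_fst, Prod.smul_snd, Prod.fst_neg,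
      Prod.snd_neg, inner_add_right, inner_smul_right, inner_neg_right, smul_eq_mul] at this
    exact le_of_mul_le_mul_left (by linarith) hτ
  have hs₀q : ⟪s₀, y - y₀⟫_ℝ = t - t₀ := by
    have : dist s s₀ < δ₂ := by rwa [dist_eq_norm]
    exact h₂ this (J q) hNs q hqK rfl
  refine tendsto_const_nhds.congr' ?_
  filter_upwards [Ioc_mem_nhdsGT (zero_lt_one' ℝ)] with τ hτ
  -- Convexity bounds g above on the segment and the subgradient `s₀` bounds it below by the same
  -- affine function, so the difference quotient is constant.
  have hval : g (y₀ + τ • (y - y₀)) = ((t₀ + τ * (t - t₀) : ℝ) : EReal) := by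
    refine le_antisymm ?_ ?_
    · have := hg.le_combo hgt₀.le hgt.le (sub_nonneg.2 hτ.2) hτ.1.le (sub_add_cancel 1 τ)
      convert this using 2
      · module
      · ring
    · have := hs₀.2 (y₀ + τ • (y - y₀))
      rw [hgt₀, add_sub_cancel_left, inner_smul_right, hs₀q] at this
      exact_mod_cast this
  rw [hval, hgt₀, hs₀q, ← EReal.coe_sub, ← EReal.coe_div, add_sub_cancel_left,
    mul_div_cancel_left₀ _ hτ.1.ne']

/-- Existence of the proximal point of a polyhedral function, its optimality condition, and its
distance from a reference point of the graph of the subdifferential. -/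
theorem exists_proximal_point [FiniteDimensional ℝ F] {g : F → EReal}
    (hg : IsPolyhedralFunction g) {y₀ s₀ : F} (hs₀ : s₀ ∈ subdifferential g y₀) {β : ℝ}
    (hβ : 0 < β) (s u : F) :
    ∃ y : F, s + β • (u - y) ∈ subdifferential g y ∧
      β * ‖y - y₀‖ ≤ 2 * (‖s - s₀‖ + β * ‖u - y₀‖) ∧
      ∀ z, g y + ((⟪s, u - y⟫_ℝ + β / 2 * ‖u - y‖ ^ 2 : ℝ) : EReal) ≤
        g z + ((⟪s, u - z⟫_ℝ + β / 2 * ‖u - z‖ ^ 2 : ℝ) : EReal) := by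
  set t₀ := (g y₀).toReal with ht₀
  have hgt₀ : g y₀ = (t₀ : EReal) := (coe_toReal_of_mem_subdifferential hg hs₀).symm
  let q (z : F) : ℝ := ⟪s, u - z⟫_ℝ + β / 2 * ‖u - z‖ ^ 2
  have hqc : Continuous q := by fun_prop
  -- Replacing g by its affine minorant at `y₀` leaves (β/2)‖z - y₀‖² ≤ (‖s - s₀‖ + β‖u - y₀‖)‖z -
  -- y₀‖.
  have hbound : ∀ (z : F) (t : ℝ), g z ≤ (t : EReal) → t + q z ≤ t₀ + q y₀ →
      β * ‖z - y₀‖ ≤ 2 * (‖s - s₀‖ + β * ‖u - y₀‖) := by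
    intro z t hz hle
    have h1 := subgradient_le hg hs₀ hz
    have h2 : ‖u - z‖ ^ 2 = ‖u - y₀‖ ^ 2 - 2 * ⟪u - y₀, z - y₀⟫_ℝ + ‖z - y₀‖ ^ 2 := by
      rw [← norm_sub_sq_real, sub_sub_sub_cancel_right]
    have h3 : ⟪s, u - z⟫_ℝ = ⟪s, u - y₀⟫_ℝ - ⟪s, z - y₀⟫_ℝ := by
      rw [← inner_sub_right, sub_sub_sub_cancel_right]
    have h4 := real_inner_le_norm (s - s₀) (z - y₀)
    have h5 := real_inner_le_norm (u - y₀) (z - y₀)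
    rw [inner_sub_left] at h4
    simp only [q] at hle
    rw [h2, h3] at hle
    rcases (norm_nonneg (z - y₀)).eq_or_lt with h0 | h0
    · rw [← h0, mul_zero]
      have := mul_nonneg hβ.le (norm_nonneg (u - y₀))
      linarith [norm_nonneg (s - s₀)]
    · refine le_of_mul_le_mul_right ?_ h0
      nlinarith [mul_le_mul_of_nonneg_left h5 hβ.le]
  -- Minimizing t + q z over the closed epigraph makes the objective continuous, so compactness of a
  -- sublevel set suffices.
  let D : Set (F × ℝ) := {p | g p.1 ≤ (p.2 : EReal)} ∩ {p | p.2 + q p.1 ≤ t₀ + q y₀}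
  have hDclosed : IsClosed D := hg.isClosed_epigraph.inter
    (isClosed_le (continuous_snd.add (hqc.comp continuous_fst)) continuous_const)
  let R := 2 * (‖s - s₀‖ + β * ‖u - y₀‖) / β
  obtain ⟨m, hm⟩ := ((isCompact_closedBall y₀ R).image hqc).bddBelow
  have hDcompact : IsCompact D := by
    refine ((isCompact_closedBall y₀ R).prod
      (isCompact_Icc (a := t₀ - ‖s₀‖ * R) (b := t₀ + q y₀ - m))).of_isClosed_subset hDclosed ?_
    rintro ⟨z, t⟩ ⟨hz, hle⟩
    have hzR : ‖z - y₀‖ ≤ R := by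
      rw [le_div_iff₀ hβ, mul_comm]
      exact hbound z t hz hle
    have hzm : m ≤ q z := hm ⟨z, mem_closedBall_iff_norm.2 hzR, rfl⟩
    have h1 := subgradient_le hg hs₀ hz
    have h2 := (abs_le.1 (abs_real_inner_le_norm s₀ (z - y₀))).1
    have h3 : ‖s₀‖ * ‖z - y₀‖ ≤ ‖s₀‖ * R := by gcongr
    change t + q z ≤ t₀ + q y₀ at hle
    exact ⟨mem_closedBall_iff_norm.2 hzR, by change t₀ - ‖s₀‖ * R ≤ t; linarith,
      by change t ≤ t₀ + q y₀ - m; linarith⟩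
  obtain ⟨⟨y, t⟩, ⟨hyt, hle⟩, hmin⟩ := hDcompact.exists_isMinOn ⟨(y₀, t₀), hgt₀.le, le_refl (t₀ + q y₀)⟩
    (f := fun p : F × ℝ => p.2 + q p.1)
    (continuous_snd.add (hqc.comp continuous_fst)).continuousOn
  change g y ≤ (t : EReal) at hyt
  change t + q y ≤ t₀ + q y₀ at hle
  have hmin' : ∀ (z : F) (τ : ℝ), g z ≤ (τ : EReal) → t + q y ≤ τ + q z := by
    intro z τ hz
    by_cases h : τ + q z ≤ t₀ + q y₀
    · exact hmin (show (z, τ) ∈ D from ⟨hz, h⟩)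
    · exact hle.trans (not_le.1 h).le
  have hgy : g y = (t : EReal) := by
    have hne : g y ≠ ⊤ := (hyt.trans_lt (EReal.coe_lt_top t)).ne
    rw [← EReal.coe_toReal hne (hg.1 y)] at hyt ⊢
    have := hmin' y (g y).toReal (EReal.coe_toReal hne (hg.1 y)).ge
    have h2 : (g y).toReal ≤ t := by exact_mod_cast hyt
    rw [show (g y).toReal = t by linarith]
  refine ⟨y, ⟨by rw [hgy]; exact EReal.coe_ne_top t, fun z => ?_⟩, hbound y t hyt hle, fun z => ?_⟩
  · rcases eq_or_ne (g z) ⊤ with hz | hz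
    · rw [hz]; exact le_top
    have hzt := EReal.coe_toReal hz (hg.1 z)
    set τ := (g z).toReal
    rw [hgy, ← hzt]
    suffices h : ⟪s + β • (u - y), z - y⟫_ℝ ≤ τ - t by
      exact_mod_cast (by linarith : t + ⟪s + β • (u - y), z - y⟫_ℝ ≤ τ)
    -- Minimality is tested along the segment from y to z and divided by θ; letting θ ↓ 0 removes
    -- the quadratic term.
    have hstep : ∀ θ ∈ Set.Ioc (0 : ℝ) 1,
        ⟪s + β • (u - y), z - y⟫_ℝ - β / 2 * θ * ‖z - y‖ ^ 2 ≤ τ - t := by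
      intro θ hθ
      have h := hmin' _ _ (hg.le_combo hgy.le hzt.ge (sub_nonneg.2 hθ.2) hθ.1.le
        (sub_add_cancel 1 θ))
      have e : u - ((1 - θ) • y + θ • z) = (u - y) - θ • (z - y) := by module
      simp only [q] at h
      rw [e, norm_sub_sq_real (u - y), inner_sub_right s (u - y), inner_smul_right, inner_smul_right, norm_smul,
        Real.norm_of_nonneg hθ.1.le] at h
      rw [inner_add_left, real_inner_smul_left]
      refine le_of_mul_le_mul_left ?_ hθ.1
      linarith
    have hlim : Tendsto (fun θ : ℝ => ⟪s + β • (u - y), z - y⟫_ℝ - β / 2 * θ * ‖z - y‖ ^ 2)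
        (𝓝[>] 0) (𝓝 (⟪s + β • (u - y), z - y⟫_ℝ - β / 2 * 0 * ‖z - y‖ ^ 2)) :=
      (Continuous.tendsto (by fun_prop) 0).mono_left nhdsWithin_le_nhds
    rw [mul_zero, zero_mul, sub_zero] at hlim
    refine le_of_tendsto hlim ?_
    filter_upwards [Ioc_mem_nhdsGT (zero_lt_one' ℝ)] with θ hθ using hstep θ hθ
  · rcases eq_or_ne (g z) ⊤ with hz | hz
    · rw [hz, EReal.top_add_coe]; exact le_top
    have hzt := EReal.coe_toReal hz (hg.1 z)
    rw [hgy, ← hzt]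
    exact_mod_cast hmin' z _ hzt.ge

end Polyhedral

/-! ### Second-order estimates. -/

section SecondOrder

variable {E F : Type*} [NormedAddCommGroup E] [InnerProductSpace ℝ E]
  [NormedAddCommGroup F] [InnerProductSpace ℝ F]

/-- A second-order lower estimate of the convexity gap near a point where the Hessian exists and
is continuous. -/
theorem HessianContinuousNear.exists_convexity_gap [CompleteSpace E] {f : E → ℝ} {x₀ : E}
    (hf : HessianContinuousNear f x₀) {ε : ℝ} (hε : 0 < ε) :
    ∃ ρ > 0, ∀ x ∈ Metric.ball x₀ ρ, ∀ z ∈ Metric.ball x₀ ρ, ∀ a b : ℝ, 0 < a → 0 < b →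
      a + b = 1 → f (a • x + b • z) + a * b / 2 *
        (⟪hessian f x₀ (x - z), x - z⟫_ℝ - ε * ‖x - z‖ ^ 2) ≤ a * f x + b * f z := by
  obtain ⟨U, hU, hd, hcont⟩ := hf
  have hc : ContinuousAt (hessian f) x₀ := hcont.continuousAt hU
  obtain ⟨ρ, hρ, hball⟩ := Metric.eventually_nhds_iff_ball.1
    ((hc.eventually (Metric.ball_mem_nhds _ hε)).and hU)
  refine ⟨ρ, hρ, fun x hx z hz a b ha hb hab => ?_⟩
  set H := hessian f x₀ with hH
  have hconv := convex_ball x₀ ρ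
  have hgrad : ∀ p ∈ Metric.ball x₀ ρ, ∀ r ∈ Metric.ball x₀ ρ,
      ‖gradient f r - gradient f p - H (r - p)‖ ≤ ε * ‖r - p‖ := by
    intro p hp r hr
    refine hconv.norm_image_sub_le_of_norm_hasFDerivWithin_le' (f' := hessian f) (𝕜 := ℝ)
      (fun w hw => ?_) (fun w hw => ?_) hp hr
    · exact (hd w (hball w hw).2).2.hasFDerivAt.hasFDerivWithinAt
    · have := (hball w hw).1
      rw [dist_eq_norm] at this
      exact this.le
  set v := x - z with hv
  set κ := ⟪H v, v⟫_ℝ - ε * ‖v‖ ^ 2 with hκ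
  have hmem : ∀ t ∈ Set.Icc (0 : ℝ) 1, z + t • v ∈ Metric.ball x₀ ρ := fun t ht =>
    hconv.add_smul_sub_mem hz hx ht
  -- Subtracting this quadratic from f along the segment leaves a function with monotone derivative,
  -- because `hgrad` controls the deviation of ∇f from H.
  let ψ (t : ℝ) : ℝ := f (z + t • v) - κ / 2 * t ^ 2
  have hψ : ∀ t ∈ Set.Icc (0 : ℝ) 1,
      HasDerivAt ψ (⟪gradient f (z + t • v), v⟫_ℝ - κ * t) t := by
    intro t ht
    have h1 : HasDerivAt (fun t : ℝ => z + t • v) v t := by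
      simpa using ((hasDerivAt_id t).smul_const v).const_add z
    have h2 := (hd _ (hball _ (hmem t ht)).2).1.hasGradientAt.hasFDerivAt.comp_hasDerivAt t h1
    have h3 := h2.sub (((hasDerivAt_id t).pow 2).const_mul (κ / 2))
    refine h3.congr_deriv ?_
    simp
    ring
  have hψconv : ConvexOn ℝ (Set.Icc (0 : ℝ) 1) ψ := by
    refine MonotoneOn.convexOn_of_deriv (convex_Icc 0 1)
      (fun t ht => (hψ t ht).continuousAt.continuousWithinAt)
      (fun t ht => (hψ t (interior_subset ht)).differentiableAt.differentiableWithinAt) ?_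
    intro t ht r hr htr
    replace ht := interior_subset ht
    replace hr := interior_subset hr
    rw [(hψ t ht).deriv, (hψ r hr).deriv]
    have h1 := hgrad _ (hmem t ht) _ (hmem r hr)
    have e : z + r • v - (z + t • v) = (r - t) • v := by module
    rw [e, norm_smul, Real.norm_of_nonneg (sub_nonneg.2 htr)] at h1
    have h2 := (abs_le.1 (abs_real_inner_le_norm
      (gradient f (z + r • v) - gradient f (z + t • v) - H ((r - t) • v)) v)).1
    rw [inner_sub_left, inner_sub_left, map_smul, real_inner_smul_left] at h2
    rw [map_smul] at h1
    have h3 := mul_le_mul_of_nonneg_right h1 (norm_nonneg v)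
    rw [hκ]
    linarith
  have h := hψconv.2 (Set.right_mem_Icc.2 zero_le_one) (Set.left_mem_Icc.2 zero_le_one)
    ha.le hb.le hab
  have e1 : z + a • v = a • x + b • z := by
    obtain rfl : b = 1 - a := by linarith
    rw [hv]; module
  have e2 : z + (1 : ℝ) • v = x := by rw [hv]; module
  simp only [ψ, smul_eq_mul, mul_one, mul_zero, add_zero, e1, e2, zero_smul] at h
  obtain rfl : b = 1 - a := by linarith
  linarith

/-- Positive definiteness of a quadratic form on a subspace cut out by `A v ∈ S` passes to the
penalized form. -/
theorem exists_penalty [FiniteDimensional ℝ E] [FiniteDimensional ℝ F] (V : Submodule ℝ E)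
    (S : Submodule ℝ F) (H : E →L[ℝ] E) (A : E →L[ℝ] F)
    (hpos : ∀ v ∈ V, A v ∈ S → v ≠ 0 → 0 < ⟪H v, v⟫_ℝ) :
    ∃ β₀ > 0, ∃ σ > 0, ∀ v ∈ V, ∀ w ∈ S,
      σ * ‖v‖ ^ 2 ≤ ⟪H v, v⟫_ℝ + β₀ * ‖A v - w‖ ^ 2 := by
  let P : F →L[ℝ] F := S.starProjection
  let r (v : E) : ℝ := ‖A v - P (A v)‖ ^ 2
  have hrc : Continuous r := by fun_prop
  let B : Set E := Metric.sphere 0 1 ∩ V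
  have hB : IsCompact B := (isCompact_sphere (0 : E) 1).inter_right V.closed_of_finiteDimensional
  -- These open sets increase with N and cover the compact unit sphere of `V`, so a single N works.
  obtain ⟨N, hN⟩ := hB.elim_directed_cover (fun N : ℕ => {v | 0 < ⟪H v, v⟫_ℝ + N * r v})
    (fun N => isOpen_lt continuous_const (by fun_prop)) (by
      rintro v ⟨hv1, hvV⟩
      have hv0 : v ≠ 0 := ne_zero_of_mem_unit_sphere ⟨v, hv1⟩
      rw [Set.mem_iUnion]
      by_cases hAv : A v ∈ S
      · exact ⟨0, by simpa using hpos v hvV hAv hv0⟩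
      · have hr : 0 < r v := by
          have : A v - P (A v) ≠ 0 := fun h => hAv (by
            rw [sub_eq_zero.1 h]; exact S.starProjection_apply_mem _)
          positivity
        obtain ⟨N, hN⟩ := exists_nat_gt (-⟪H v, v⟫_ℝ / r v)
        refine ⟨N, ?_⟩
        rw [div_lt_iff₀ hr] at hN
        change 0 < ⟪H v, v⟫_ℝ + N * r v
        linarith) (directed_of_isDirected_le fun M N hMN v hv => by
      have : (M : ℝ) * r v ≤ N * r v := by
        gcongr
      change 0 < ⟪H v, v⟫_ℝ + M * r v at hv
      change 0 < ⟪H v, v⟫_ℝ + N * r v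
      linarith)
  obtain ⟨σ, hσ, hσB⟩ : ∃ σ > 0, ∀ v ∈ B, σ ≤ ⟪H v, v⟫_ℝ + N * r v := by
    rcases B.eq_empty_or_nonempty with h | h
    · exact ⟨1, one_pos, by simp [h]⟩
    · obtain ⟨v, hv, hmin⟩ := hB.exists_isMinOn h
        (f := fun v => ⟪H v, v⟫_ℝ + N * r v) (by fun_prop)
      exact ⟨_, hN hv, fun w hw => hmin hw⟩
  -- The extra 1 makes the penalty positive even when N = 0.
  refine ⟨N + 1, by positivity, σ, hσ, fun v hv w hw => ?_⟩
  have hdist : r v ≤ ‖A v - w‖ ^ 2 := by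
    have : ‖A v - P (A v)‖ ≤ ‖A v - w‖ := by
      rw [S.starProjection_minimal]
      exact ciInf_le ⟨0, by rintro _ ⟨x, rfl⟩; positivity⟩ (⟨w, hw⟩ : S)
    simp only [r]
    gcongr
  have hmain : σ * ‖v‖ ^ 2 ≤ ⟪H v, v⟫_ℝ + N * r v := by
    rcases eq_or_ne v 0 with rfl | hv0
    · simp [r]
    have hn : 0 < ‖v‖ := norm_pos_iff.2 hv0
    have h := hσB (‖v‖⁻¹ • v) ⟨by simp [norm_smul, hn.ne'], V.smul_mem _ hv⟩
    have e : r (‖v‖⁻¹ • v) = ‖v‖⁻¹ ^ 2 * r v := by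
      simp only [r, map_smul, ← smul_sub, norm_smul, mul_pow, norm_inv, norm_norm]
    rw [e, map_smul, real_inner_smul_left, inner_smul_right] at h
    have h2 := mul_le_mul_of_nonneg_right h (sq_nonneg ‖v‖)
    refine h2.trans_eq ?_
    field_simp
  have : (N : ℝ) * r v ≤ (N + 1) * ‖A v - w‖ ^ 2 := by gcongr; linarith
  linarith

end SecondOrder

/-! ### Concavity and convexity gap of the reduced Lagrangian. -/

section ReducedLagrangian

variable {E F : Type*} [NormedAddCommGroup E] [InnerProductSpace ℝ E]
  [NormedAddCommGroup F] [InnerProductSpace ℝ F]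
  {C : Set E} {f : E → ℝ} {g : F → EReal} {A : E →L[ℝ] F} {β : ℝ}

theorem augLagrangian_of_mem {x : E} (hx : x ∈ C) (y s : F) :
    augLagrangian C f g A β x y s =
      f x + (g y + ((⟪s, A x - y⟫_ℝ + β / 2 * ‖A x - y‖ ^ 2 : ℝ) : EReal)) := by
  rw [augLagrangian, indicatorFun, if_pos hx, add_zero, add_assoc]

theorem augLagrangian_of_notMem (hg : ∀ y, g y ≠ ⊥) {x : E} (hx : x ∉ C) (y s : F) :
    augLagrangian C f g A β x y s = ⊤ := by
  rw [augLagrangian, indicatorFun, if_neg hx, EReal.coe_add_top, EReal.top_add_of_ne_bot (hg y),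
    EReal.top_add_coe]

theorem reducedLagrangian_of_notMem (hg : ∀ y, g y ≠ ⊥) {x : E} (hx : x ∉ C) (s : F) :
    reducedLagrangian C f g A β x s = ⊤ := by
  simp [reducedLagrangian, augLagrangian_of_notMem hg hx]

/-- Where finite, the augmented Lagrangian is affine in the multiplier for fixed x and y; an infimum
of such functions is concave. -/
theorem isConcaveOn_reducedLagrangian (hg : ∀ y, g y ≠ ⊥) (x : E) (Y : Set F) :
    IsConcaveOn Y (fun s => reducedLagrangian C f g A β x s) := by
  intro s _ r _ a b ha hb hab
  refine le_iInf fun y => ?_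
  by_cases hx : x ∈ C
  swap
  · rw [augLagrangian_of_notMem hg hx]; exact le_top
  rcases eq_or_ne (g y) ⊤ with hy | hy
  · rw [augLagrangian_of_mem hx, hy, EReal.top_add_coe, EReal.coe_add_top]; exact le_top
  have hle (s : F) (c : ℝ) (hc : 0 < c) : (c : EReal) * reducedLagrangian C f g A β x s ≤
      (c : EReal) * augLagrangian C f g A β x y s :=
    mul_le_mul_of_nonneg_left (iInf_le _ y) (by exact_mod_cast hc.le)
  refine (add_le_add (hle s a ha) (hle r b hb)).trans_eq ?_
  rw [augLagrangian_of_mem hx, augLagrangian_of_mem hx, augLagrangian_of_mem hx,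
    ← EReal.coe_toReal hy (hg y)]
  norm_cast
  rw [inner_add_left, real_inner_smul_left, real_inner_smul_left]
  obtain rfl : b = 1 - a := by linarith
  ring

/-- A minimizer of the augmented Lagrangian in `y` gives the value of the reduced one. -/
theorem reducedLagrangian_eq {x : E} (hx : x ∈ C) {y s : F} {t : ℝ} (hy : g y = t)
    (hmin : ∀ z, g y + ((⟪s, A x - y⟫_ℝ + β / 2 * ‖A x - y‖ ^ 2 : ℝ) : EReal) ≤
        g z + ((⟪s, A x - z⟫_ℝ + β / 2 * ‖A x - z‖ ^ 2 : ℝ) : EReal)) :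
    reducedLagrangian C f g A β x s =
      ((f x + (t + (⟪s, A x - y⟫_ℝ + β / 2 * ‖A x - y‖ ^ 2)) : ℝ) : EReal) := by
  have h : ((f x + (t + (⟪s, A x - y⟫_ℝ + β / 2 * ‖A x - y‖ ^ 2)) : ℝ) : EReal) =
      augLagrangian C f g A β x y s := by
    rw [augLagrangian_of_mem hx, hy]
    norm_cast
  rw [h]
  refine le_antisymm (iInf_le _ y) (le_iInf fun z => ?_)
  rw [augLagrangian_of_mem hx, augLagrangian_of_mem hx]
  exact add_le_add_right (hmin z) _

/-- Convexity gap of the reduced Lagrangian in terms of that of `f` and of minimizers in `y`. -/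
theorem reducedLagrangian_combo_le (hC : Convex ℝ C) (hg : IsPolyhedralFunction g) {x z : E}
    (hx : x ∈ C) (hz : z ∈ C) {y w s : F} {t τ : ℝ} (hy : g y = t) (hw : g w = τ)
    (hymin : ∀ z, g y + ((⟪s, A x - y⟫_ℝ + β / 2 * ‖A x - y‖ ^ 2 : ℝ) : EReal) ≤
        g z + ((⟪s, A x - z⟫_ℝ + β / 2 * ‖A x - z‖ ^ 2 : ℝ) : EReal))
    (hwmin : ∀ y, g w + ((⟪s, A z - w⟫_ℝ + β / 2 * ‖A z - w‖ ^ 2 : ℝ) : EReal) ≤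
        g y + ((⟪s, A z - y⟫_ℝ + β / 2 * ‖A z - y‖ ^ 2 : ℝ) : EReal))
    {a b κ : ℝ} (ha : 0 < a) (hb : 0 < b) (hab : a + b = 1)
    (hgap : f (a • x + b • z) + κ ≤
      a * f x + b * f z + β / 2 * (a * b) * ‖A (x - z) - (y - w)‖ ^ 2) :
    reducedLagrangian C f g A β (a • x + b • z) s + (κ : EReal) ≤
      (a : EReal) * reducedLagrangian C f g A β x s +
        (b : EReal) * reducedLagrangian C f g A β z s := by
  have hle : reducedLagrangian C f g A β (a • x + b • z) s ≤
      ((f (a • x + b • z) + ((a * t + b * τ) + (⟪s, a • (A x - y) + b • (A z - w)⟫_ℝ +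
        β / 2 * ‖a • (A x - y) + b • (A z - w)‖ ^ 2)) : ℝ) : EReal) := by
    refine (iInf_le _ (a • y + b • w)).trans ?_
    rw [augLagrangian_of_mem (hC hx hz ha.le hb.le hab)]
    have e : A (a • x + b • z) - (a • y + b • w) = a • (A x - y) + b • (A z - w) := by
      rw [map_add, map_smul, map_smul]; module
    rw [e, EReal.coe_add (f _), EReal.coe_add (a * t + b * τ)]
    exact add_le_add_right (add_le_add_left (hg.le_combo hy.le hw.le ha.le hb.le hab) _) _
  rw [reducedLagrangian_eq hx hy hymin, reducedLagrangian_eq hz hw hwmin]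
  refine (add_le_add_left hle _).trans ?_
  norm_cast
  have e : A (x - z) - (y - w) = (A x - y) - (A z - w) := by rw [map_sub]; abel
  rw [e, norm_sub_sq_real] at hgap
  rw [norm_add_sq_real, inner_add_right, inner_smul_right, inner_smul_right,
    real_inner_smul_left, inner_smul_right, norm_smul, norm_smul, Real.norm_of_nonneg ha.le,
    Real.norm_of_nonneg hb.le]
  obtain rfl : b = 1 - a := by linarith
  linarith

end ReducedLagrangian

/-! ### Assembly of the estimates. -/

section StrongVariationalSufficiency

variable {E F : Type*} [NormedAddCommGroup E] [InnerProductSpace ℝ E] [FiniteDimensional ℝ E]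
  [NormedAddCommGroup F] [InnerProductSpace ℝ F] [FiniteDimensional ℝ F]

theorem strongVariationalSufficiency_of_secondOrder [CompleteSpace E] {C : Set E} {f : E → ℝ}
    {g : F → EReal} {A : E →L[ℝ] F} (hC : Convex ℝ C) (hg : IsPolyhedralFunction g) {x₀ : E}
    {s₀ : F} (hs₀ : s₀ ∈ subdifferential g (A x₀)) (h2 : SecondOrderCondition C f g A x₀ s₀) :
    StrongVariationalSufficiency C f g A x₀ s₀ := by
  obtain ⟨hHess, hpos⟩ := h2
  obtain ⟨β₀, hβ₀, σ, hσ, hpen⟩ := exists_penalty (affineSpan ℝ C).direction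
    (critSpan g (A x₀) s₀) (hessian f x₀) A hpos
  -- Half of σ absorbs the variation of the Hessian; the other half is the final modulus.
  obtain ⟨ρ, hρ, hgapf⟩ := hHess.exists_convexity_gap (half_pos hσ)
  obtain ⟨ε, hε, hcrit⟩ := exists_sub_mem_critCone hg hs₀
  refine ⟨β₀, hβ₀, fun β hβ => ?_⟩
  have hβpos : 0 < β := hβ₀.trans_le hβ
  -- With s and βAx within η of `s₀` and βAx₀, the proximal point satisfies β‖y - Ax₀‖ < 4η ≤ βε/2,
  -- and its subgradient is within 6η < ε of `s₀`.
  have hη : 0 < min (ε / 8) (β * ε / 8) := by positivity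
  set η := min (ε / 8) (β * ε / 8)
  have hη1 : η ≤ ε / 8 := min_le_left _ _
  have hη2 : η ≤ β * ε / 8 := min_le_right _ _
  set θ := η / (β * (‖A‖ + 1)) with hθdef
  have hθ : 0 < θ := by positivity
  have hA (x : E) (hx : x ∈ Metric.ball x₀ θ) : β * ‖A x - A x₀‖ ≤ η := by
    rw [← map_sub]
    have h1 := A.le_opNorm (x - x₀)
    have h3 : ‖A‖ * ‖x - x₀‖ ≤ (‖A‖ + 1) * θ := by
      gcongr
      · linarith
      · exact (mem_ball_iff_norm.1 hx).le
    calc β * ‖A (x - x₀)‖ ≤ β * ((‖A‖ + 1) * θ) := by gcongr; linarith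
      _ = η := by rw [hθdef]; field_simp
  have hprox (x : E) (hx : x ∈ Metric.ball x₀ θ) (s : F) (hs : s ∈ Metric.ball s₀ η) :
      ∃ (y : F) (t : ℝ), g y = t ∧ y - A x₀ ∈ critCone g (A x₀) s₀ ∧
        ∀ z, g y + ((⟪s, A x - y⟫_ℝ + β / 2 * ‖A x - y‖ ^ 2 : ℝ) : EReal) ≤
          g z + ((⟪s, A x - z⟫_ℝ + β / 2 * ‖A x - z‖ ^ 2 : ℝ) : EReal) := by
    obtain ⟨y, hsub, hdist, hmin⟩ := exists_proximal_point hg hs₀ hβpos s (A x)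
    have hs' := mem_ball_iff_norm.1 hs
    have hA' := hA x hx
    have hyd : β * ‖y - A x₀‖ < 4 * η := by linarith
    refine ⟨y, (g y).toReal, (coe_toReal_of_mem_subdifferential hg hsub).symm,
      hcrit y _ ?_ ?_ hsub, hmin⟩
    · refine lt_of_mul_lt_mul_left (a := β) ?_ hβpos.le
      linarith [mul_pos hβpos hε]
    · have e : s + β • (A x - y) - s₀ = (s - s₀) + β • ((A x - A x₀) - (y - A x₀)) := by module
      rw [e]
      have h1 := norm_add_le (s - s₀) (β • ((A x - A x₀) - (y - A x₀)))
      rw [norm_smul, Real.norm_of_nonneg hβpos.le] at h1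
      have h3 := mul_le_mul_of_nonneg_left (norm_sub_le (A x - A x₀) (y - A x₀)) hβpos.le
      linarith
  refine ⟨Metric.ball x₀ (min ρ θ), Metric.ball_mem_nhds _ (lt_min hρ hθ),
    Metric.ball s₀ η, Metric.ball_mem_nhds _ hη, convex_ball _ _, convex_ball _ _,
    ⟨σ / 2, half_pos hσ, fun s hs x hx z hz a b ha hb hab => ?_⟩,
    fun x _ => isConcaveOn_reducedLagrangian hg.1 x _⟩
  have hρ' := Metric.ball_subset_ball (x := x₀) (min_le_left ρ θ)
  have hθ' := Metric.ball_subset_ball (x := x₀) (min_le_right ρ θ)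
  -- In `EReal`, ⊤ + ⊥ = ⊥, so the value ⊥ must be excluded before an endpoint outside `C` makes the
  -- right-hand side ⊤.
  have hne (x : E) (hx : x ∈ Metric.ball x₀ (min ρ θ)) :
      reducedLagrangian C f g A β x s ≠ ⊥ := by
    by_cases hxC : x ∈ C
    · obtain ⟨y, t, hy, -, hmin⟩ := hprox x (hθ' hx) s hs
      rw [reducedLagrangian_eq hxC hy hmin]
      exact EReal.coe_ne_bot _
    · rw [reducedLagrangian_of_notMem hg.1 hxC]; exact top_ne_bot
  have hmul_ne {c : ℝ} (hc : 0 < c) {e : EReal} (he : e ≠ ⊥) : (c : EReal) * e ≠ ⊥ := by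
    induction e with
    | bot => exact absurd rfl he
    | top => rw [EReal.coe_mul_top_of_pos hc]; exact top_ne_bot
    | coe r => rw [← EReal.coe_mul]; exact EReal.coe_ne_bot _
  by_cases hxC : x ∈ C
  swap
  · change _ ≤ (a : EReal) * reducedLagrangian C f g A β x s +
      (b : EReal) * reducedLagrangian C f g A β z s
    rw [reducedLagrangian_of_notMem hg.1 hxC, EReal.coe_mul_top_of_pos ha,
      EReal.top_add_of_ne_bot (hmul_ne hb (hne z hz))]
    exact le_top
  by_cases hzC : z ∈ C
  swap
  · change _ ≤ (a : EReal) * reducedLagrangian C f g A β x s +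
      (b : EReal) * reducedLagrangian C f g A β z s
    rw [reducedLagrangian_of_notMem hg.1 hzC, EReal.coe_mul_top_of_pos hb,
      EReal.add_top_of_ne_bot (hmul_ne ha (hne x hx))]
    exact le_top
  obtain ⟨y, t, hy, hyc, hymin⟩ := hprox x (hθ' hx) s hs
  obtain ⟨w, τ, hw, hwc, hwmin⟩ := hprox z (hθ' hz) s hs
  refine reducedLagrangian_combo_le hC hg hxC hzC hy hw hymin hwmin ha hb hab ?_
  have hS : y - w ∈ critSpan g (A x₀) s₀ := by
    rw [← sub_sub_sub_cancel_right y w (A x₀)]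
    exact Submodule.sub_mem _ (Submodule.subset_span hyc) (Submodule.subset_span hwc)
  have hV : x - z ∈ (affineSpan ℝ C).direction :=
    AffineSubspace.vsub_mem_direction (subset_affineSpan ℝ C hxC) (subset_affineSpan ℝ C hzC)
  have h1 := hpen _ hV _ hS
  have h3 := hgapf x (hρ' hx) z (hρ' hz) a b ha hb hab
  have h4 : β₀ * ‖A (x - z) - (y - w)‖ ^ 2 ≤ β * ‖A (x - z) - (y - w)‖ ^ 2 := by gcongr
  have h5 := mul_le_mul_of_nonneg_left (h1.trans (add_le_add_right h4 _)) (mul_pos ha hb).le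
  linarith

end StrongVariationalSufficiency

end CompositeOpt

theorem mainTheorem2 (n m : ℕ)
    (C : Set (EuclideanSpace ℝ (Fin n)))
    (f : EuclideanSpace ℝ (Fin n) → ℝ)
    (g : EuclideanSpace ℝ (Fin m) → EReal)
    (A : EuclideanSpace ℝ (Fin n) →L[ℝ] EuclideanSpace ℝ (Fin m))
    (hC : Convex ℝ C) (hCne : C.Nonempty)
    (hf : CompositeOpt.ContDiffOnSet f C)
    (hg : CompositeOpt.IsPolyhedralFunction g)
    (hqual : ∃ x ∈ intrinsicInterior ℝ C, g (A x) ≠ ⊤)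
    (xbar : EuclideanSpace ℝ (Fin n)) (lbar : EuclideanSpace ℝ (Fin m))
    (hfirst : CompositeOpt.FirstOrderCondition C f g A xbar lbar)
    (hsecond : CompositeOpt.SecondOrderCondition C f g A xbar lbar) :
    CompositeOpt.StrongVariationalSufficiency C f g A xbar lbar := by
  exact CompositeOpt.strongVariationalSufficiency_of_secondOrder hC hg hfirst.2 hsecond
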